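/- Let $(\Omega,\mathcal F,(\mathcal F_t)_{t\in[0,\bar T]},\mathbb Q)$ be a filtered probability space with $\bar T<\infty$, and let $J=(J_t)_{t\in[0,\bar T]}$ be an adapted process with values in $S=\{1,\dots,n\}$ and almost surely right-continuous paths that is a time-homogeneous continuous-time Markov chain with respect to $(\mathcal F_t)$ with generator matrix $\mathbf G=(g_{i,j})$; that is, there is a semigroup of stochastic matrices $(P(h))_{h\ge 0}$ with $P(0)=I$ and right derivative $P'(0)=\mathbf G$ such that $\mathbb Q(J_t=j\mid\mathcal F_s)=P(t-s)_{J_s,j}$ almost surely for all $0\le s\le t\le\bar T$ and $j\in S$ (so $\sum_j g_{i,j}=0$ and $g_{i,j}\ge 0$ for $i\ne j$). The initial distribution of $J$ is arbitrary. Let $r:S\to\mathbb R$ (the short rate at time $t$ is $r(J_t)$), let $\phi:S\to\mathbb R$, and let $0\le t\le T\le\bar T$. Put $\mathbf R=\mathrm{diag}(r(1),\dots,r(n))$ and $\Phi=(\phi(j))_{j\in S}$, and for $i\in S$ with $\mathbb Q(J_t=i)>0$ let $$u(t,i;T)=\mathbb E\Big[e^{-\int_t^T r(J_s)\,ds}\,\phi(J_T)\,\Big|\,J_t=i\Big]$$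 be the price at time $t$ in state $i$ of the claim that pays $\phi(J_T)$ at time $T$. Then the integral $\int_t^T r(J_s)\,ds$ exists almost surely, $e^{-\int_t^T r(J_s)\,ds}\phi(J_T)$ is integrable, and $$u(t,i;T)=\big(e^{(T-t)(\mathbf G-\mathbf R)}\Phi\big)_i\qquad\text{for every } i\in S \text{ with } \mathbb Q(J_t=i)>0 .$$ If moreover $J$ is irreducible (every state can be reached from every other one through jumps of positive rate) and $t>0$, then $\mathbb Q(J_t=i)>0$ for all $i\in S$, and hence the vector $U_t^T=(u(t,i;T))_{i\in S}$ satisfies $$U_t^T=e^{(T-t)(\mathbf G-\mathbf R)}\Phi .$$ -/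

import Mathlib

open MeasureTheory ProbabilityTheory

namespace CTMC

/-- A (standard) transition function on the state space `Fin n`: a semigroup of stochastic
matrices `P t`, `t ≥ 0`. Values of `P` at negative times are irrelevant. -/
structure IsTransitionFunction {n : ℕ} (P : ℝ → Matrix (Fin n) (Fin n) ℝ) : Prop where
  nonneg : ∀ t, 0 ≤ t → ∀ i j, 0 ≤ P t i j
  row_sum : ∀ t, 0 ≤ t → ∀ i, ∑ j, P t i j = 1
  zero : P 0 = 1
  add : ∀ s t, 0 ≤ s → 0 ≤ t → P (s + t) = P s * P t

/-- `G` is the generator matrix of the transition function `P`: the entrywise right derivative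
of `P` at time `0`. (For a transition function it follows that the rows of `G` sum to zero and
that its off-diagonal entries are nonnegative.) -/
def IsGeneratorOf {n : ℕ} (G : Matrix (Fin n) (Fin n) ℝ)
    (P : ℝ → Matrix (Fin n) (Fin n) ℝ) : Prop :=
  ∀ i j, HasDerivWithinAt (fun t => P t i j) (G i j) (Set.Ici 0) 0

/-- `J = (J_t)_{t ∈ [0, Tbar]}` is, on the filtered probability space `(Ω, F, Q)`, a
time-homogeneous continuous-time Markov chain with state space `Fin n` and generator matrix `G`.
Only times in `[0, Tbar]` matter. The initial distribution is arbitrary. -/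
structure IsCTMC {n : ℕ} {Ω : Type*} {mΩ : MeasurableSpace Ω} (Q : Measure Ω)
    (F : Filtration ℝ mΩ) (Tbar : ℝ) (J : ℝ → Ω → Fin n)
    (G : Matrix (Fin n) (Fin n) ℝ) : Prop where
  adapted : ∀ t ∈ Set.Icc 0 Tbar, Measurable[F t] (J t)
  /-- almost every path is right-continuous (for the discrete topology on the state space) -/
  right_continuous : ∀ᵐ ω ∂Q, ∀ t ∈ Set.Ico 0 Tbar,
    ContinuousWithinAt (fun s => J s ω) (Set.Ici t) t
  /-- the Markov property with respect to `F`, with transition function generated by `G` -/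
  markov : ∃ P : ℝ → Matrix (Fin n) (Fin n) ℝ, IsTransitionFunction P ∧ IsGeneratorOf G P ∧
    ∀ s t, 0 ≤ s → s ≤ t → t ≤ Tbar → ∀ j : Fin n,
      Q[(J t ⁻¹' {j}).indicator (fun _ => (1 : ℝ)) | F s] =ᵐ[Q] fun ω => P (t - s) (J s ω) j

/-- Irreducibility of the chain with generator matrix `G`: every state can be reached from every
other one along jumps of positive rate. -/
def IsIrreducible {n : ℕ} (G : Matrix (Fin n) (Fin n) ℝ) : Prop :=
  ∀ i j, Relation.ReflTransGen (fun a b => a ≠ b ∧ 0 < G a b) i j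

/-- The discounted payoff `exp (-∫_t^T r(J_s) ds) φ(J_T)`. -/
noncomputable def discountedPayoff {n : ℕ} {Ω : Type*} (J : ℝ → Ω → Fin n)
    (r φ : Fin n → ℝ) (t T : ℝ) (ω : Ω) : ℝ :=
  Real.exp (-∫ s in t..T, r (J s ω)) * φ (J T ω)

/-- The price `u(t, i; T) = E[exp (-∫_t^T r(J_s) ds) φ(J_T) | J_t = i]`: the expectation under
the conditional probability `Q( · | J_t = i)`, which is meaningful when `Q(J_t = i) > 0`. -/
noncomputable def price {n : ℕ} {Ω : Type*} {mΩ : MeasurableSpace Ω} (Q : Measure Ω)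
    (J : ℝ → Ω → Fin n) (r φ : Fin n → ℝ) (t T : ℝ) (i : Fin n) : ℝ :=
  ∫ ω, discountedPayoff J r φ t T ω ∂(Q[|J t ⁻¹' {i}])

end CTMC

namespace CTMC

open Filter Topology

/-! Replace the integral by its right-endpoint Riemann sum with step `h = (T - t) / N`. Conditioning
backwards one step at a time, the Markov property prices this discrete claim exactly as `(P(h)
e^{-hR})^N Φ` (`integral_mul_exp_riemannSum`). The curve `h ↦ P(h) e^{-hR}` passes through `I` with
right derivative `G - R`, so a Chernoff product formula sends its powers to `exp ((T - t)(G - R))`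
(`tendsto_pow_exp_of_hasDerivWithinAt`). On the probabilistic side the Riemann sums converge along
right-continuous paths, and dominated convergence passes to the limit. No backward equation for the
price is needed. -/

/-! ### Chernoff product formula in a Banach algebra -/

theorem norm_pow_sub_pow_le {𝔸 : Type*} [NormedRing 𝔸] [NormOneClass 𝔸] {a b : 𝔸} {K : ℝ}
    (hK : 1 ≤ K) (ha : ‖a‖ ≤ K) (hb : ‖b‖ ≤ K) (N : ℕ) :
    ‖a ^ N - b ^ N‖ ≤ N * K ^ N * ‖a - b‖ := by
  induction N with
  | zero => simp
  | succ N ih =>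
    have hK0 : 0 ≤ K := zero_le_one.trans hK
    -- Telescoping without commutativity: one factor is exchanged at a time.
    have h1 : a ^ (N + 1) - b ^ (N + 1) = a ^ N * (a - b) + (a ^ N - b ^ N) * b := by
      rw [pow_succ, pow_succ]; noncomm_ring
    have h2 : ‖a ^ N * (a - b)‖ ≤ K ^ (N + 1) * ‖a - b‖ := by
      refine (norm_mul_le _ _).trans (mul_le_mul_of_nonneg_right ?_ (norm_nonneg _))
      exact ((norm_pow_le _ _).trans (pow_le_pow_left₀ (norm_nonneg _) ha N)).trans
        (pow_le_pow_right₀ hK (Nat.le_succ N))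
    have h3 : ‖(a ^ N - b ^ N) * b‖ ≤ N * K ^ N * ‖a - b‖ * K :=
      (norm_mul_le _ _).trans (mul_le_mul ih hb (norm_nonneg _) (by positivity))
    rw [h1]
    refine (norm_add_le _ _).trans ((add_le_add h2 h3).trans (le_of_eq ?_))
    push_cast
    ring

/-- A curve through `1` with right derivative `A` at `0` satisfies an exponential bound near `0`. -/
theorem eventually_norm_le_exp {𝔸 : Type*} [NormedRing 𝔸] [NormOneClass 𝔸] [NormedAlgebra ℝ 𝔸]
    {X : ℝ → 𝔸} {A : 𝔸} (h0 : X 0 = 1) (hX : HasDerivWithinAt X A (Set.Ici 0) 0) :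
    ∀ᶠ h in 𝓝[≥] (0 : ℝ), ‖X h‖ ≤ Real.exp (h * (‖A‖ + 1)) := by
  -- The `o(h)` remainder is bounded by `h` itself, whence the `+ 1` in the exponent.
  have h1 := (hasDerivWithinAt_iff_isLittleO.1 hX).def zero_lt_one
  filter_upwards [h1, self_mem_nhdsWithin] with h hh (hh0 : 0 ≤ h)
  simp only [h0, sub_zero, one_mul, Real.norm_eq_abs, abs_of_nonneg hh0] at hh
  have h2 : X h = 1 + h • A + (X h - 1 - h • A) := by abel
  calc ‖X h‖ = ‖1 + h • A + (X h - 1 - h • A)‖ := by rw [← h2]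
    _ ≤ ‖(1 : 𝔸)‖ + ‖h • A‖ + ‖X h - 1 - h • A‖ :=
      (norm_add_le _ _).trans (add_le_add_left (norm_add_le _ _) _)
    _ ≤ 1 + h * ‖A‖ + h := by
      rw [norm_one, norm_smul, Real.norm_eq_abs, abs_of_nonneg hh0]; gcongr
    _ = h * (‖A‖ + 1) + 1 := by ring
    _ ≤ _ := Real.add_one_le_exp _

/-- A Chernoff-type product formula in a Banach algebra. -/
theorem tendsto_pow_exp_of_hasDerivWithinAt {𝔸 : Type*} [NormedRing 𝔸] [NormOneClass 𝔸]
    [NormedAlgebra ℝ 𝔸] [CompleteSpace 𝔸] {X : ℝ → 𝔸} {A : 𝔸} (h0 : X 0 = 1)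
    (hX : HasDerivWithinAt X A (Set.Ici 0) 0) {τ : ℝ} (hτ : 0 ≤ τ) :
    Tendsto (fun N : ℕ => X (τ / N) ^ N) atTop (𝓝 (NormedSpace.exp (τ • A))) := by
  -- `Y (τ / N) ^ N` is already the limit for `N > 0`; `X` and `Y` are tangent at `0`, so the powers
  -- differ by `N * O(1) * o(τ / N)`.
  let Y : ℝ → 𝔸 := fun h => NormedSpace.exp (h • A)
  have hY0 : Y 0 = 1 := by simp [Y]
  have hY : HasDerivWithinAt Y A (Set.Ici 0) 0 := by
    simpa [Y] using (hasDerivAt_exp_smul_const (𝕂 := ℝ) A 0).hasDerivWithinAt (s := Set.Ici 0)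
  have hYpow : ∀ᶠ N : ℕ in atTop, Y (τ / N) ^ N = NormedSpace.exp (τ • A) := by
    filter_upwards [eventually_gt_atTop 0] with N hN
    let : NormedAlgebra ℚ 𝔸 := NormedAlgebra.restrictScalars ℚ ℝ 𝔸
    have hN' : (N : ℝ) ≠ 0 := by exact_mod_cast hN.ne'
    rw [← NormedSpace.exp_nsmul, ← Nat.cast_smul_eq_nsmul ℝ, smul_smul, mul_div_cancel₀ _ hN']
  have hlim : Tendsto (fun N : ℕ => τ / (N : ℝ)) atTop (𝓝[≥] 0) :=
    tendsto_nhdsWithin_iff.2 ⟨tendsto_const_div_atTop_nhds_zero_nat τ,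
      Eventually.of_forall fun N => div_nonneg hτ N.cast_nonneg⟩
  have hdiff : (fun h => X h - Y h) =o[𝓝[≥] 0] fun h => h := by
    have := hasDerivWithinAt_iff_isLittleO.1 (hX.sub hY)
    simpa [h0, hY0] using this
  have hsub : Tendsto (fun N : ℕ => X (τ / N) ^ N - Y (τ / N) ^ N) atTop (𝓝 0) := by
    rw [Metric.tendsto_nhds]
    intro ε hε
    -- `C` vanishes when `τ = 0`, so `ε` is divided by `C + 1`.
    set C := Real.exp (τ * (‖A‖ + 1)) * τ
    have hC : 0 ≤ C := by positivity
    have hδ : 0 < ε / (C + 1) := by positivity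
    filter_upwards [hlim.eventually (hdiff.def hδ), hlim.eventually (eventually_norm_le_exp h0 hX),
      hlim.eventually (eventually_norm_le_exp hY0 hY), eventually_gt_atTop 0] with N h1 h2 h3 hN
    have hN' : (N : ℝ) ≠ 0 := by exact_mod_cast hN.ne'
    have hh : 0 ≤ τ / N := by positivity
    rw [dist_zero_right]
    have h4 := norm_pow_sub_pow_le (Real.one_le_exp (by positivity)) h2 h3 N
    have h5 : Real.exp (τ / N * (‖A‖ + 1)) ^ N = Real.exp (τ * (‖A‖ + 1)) := by
      rw [← Real.exp_nat_mul]; congr 1; field_simp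
    rw [Real.norm_eq_abs, abs_of_nonneg hh] at h1
    rw [h5] at h4
    calc _ ≤ _ := h4
      _ ≤ N * Real.exp (τ * (‖A‖ + 1)) * (ε / (C + 1) * (τ / N)) := by gcongr
      _ = C * (ε / (C + 1)) := by simp only [C]; field_simp
      _ < (C + 1) * (ε / (C + 1)) := by gcongr; linarith
      _ = ε := by field_simp
  have := hsub.add (tendsto_nhds_of_eventually_eq hYpow)
  simpa using this

/-! ### Riemann sums of right-continuous functions -/

/-- Right-endpoint step approximations of a right-continuous function. -/
theorem tendsto_comp_ceil_div {g : ℝ → ℝ} (hg : ∀ x ∈ Set.Ico (0 : ℝ) 1,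
    ContinuousWithinAt g (Set.Ici x) x) {x : ℝ} (hx : x ∈ Set.Ico (0 : ℝ) 1) :
    Tendsto (fun N : ℕ => g (⌈x * N⌉₊ / N)) atTop (𝓝 (g x)) := by
  have h1 : Tendsto (fun N : ℕ => (⌈x * N⌉₊ : ℝ) / N) atTop (𝓝 x) :=
    (tendsto_nat_ceil_mul_div_atTop hx.1).comp tendsto_natCast_atTop_atTop
  -- Rounding up approaches `x` from the right, so right-continuity suffices.
  refine (hg x hx).tendsto.comp (tendsto_nhdsWithin_iff.2 ⟨h1, ?_⟩)
  filter_upwards [eventually_gt_atTop 0] with N hN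
  have hN' : (0 : ℝ) < N := by exact_mod_cast hN
  exact (le_div_iff₀ hN').2 (Nat.le_ceil _)

theorem measurable_comp_ceil_div (g : ℝ → ℝ) (N : ℕ) :
    Measurable fun x : ℝ => g (⌈x * N⌉₊ / N) :=
  (measurable_from_top (f := fun k : ℕ => g (k / N))).comp
    (Nat.measurable_ceil.comp (measurable_id.mul_const _))

/-- Measurability comes from the step functions, which converge pointwise on `[0, 1)`. -/
theorem intervalIntegrable_of_bounded_of_rightContinuous {g : ℝ → ℝ} {C : ℝ}
    (hC : ∀ x, |g x| ≤ C)
    (hg : ∀ x ∈ Set.Ico (0 : ℝ) 1, ContinuousWithinAt g (Set.Ici x) x) :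
    IntervalIntegrable g volume 0 1 := by
  rw [intervalIntegrable_iff_integrableOn_Ico_of_le zero_le_one]
  refine Integrable.of_bound ?_ C (ae_of_all _ hC)
  refine aestronglyMeasurable_of_tendsto_ae (u := atTop)
    (f := fun (N : ℕ) (x : ℝ) => g (⌈x * N⌉₊ / N))
    (fun N => (measurable_comp_ceil_div g N).aestronglyMeasurable) ?_
  filter_upwards [ae_restrict_mem measurableSet_Ico] with x hx
  exact tendsto_comp_ceil_div hg hx

theorem integral_comp_ceil_div (g : ℝ → ℝ) {C : ℝ} (hC : ∀ x, |g x| ≤ C) {N : ℕ} (hN : 0 < N) :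
    ∫ x in (0 : ℝ)..1, g (⌈x * N⌉₊ / N) = ∑ k ∈ Finset.range N, g ((k + 1 : ℕ) / N) * (1 / N) := by
  have hN' : (0 : ℝ) < N := by exact_mod_cast hN
  have h := intervalIntegral.sum_integral_adjacent_intervals (μ := volume)
    (f := fun x : ℝ => g (⌈x * N⌉₊ / N)) (a := fun k : ℕ => (k : ℝ) / N) (n := N) ?_
  · simp only [Nat.cast_zero, zero_div, div_self hN'.ne'] at h
    rw [← h]
    refine Finset.sum_congr rfl fun k _ => ?_
    have hle : (k : ℝ) / N ≤ (k + 1 : ℕ) / N := by gcongr; simp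
    rw [intervalIntegral.integral_of_le hle,
      setIntegral_congr_fun (g := fun _ => g ((k + 1 : ℕ) / N)) measurableSet_Ioc]
    · rw [setIntegral_const, smul_eq_mul, mul_comm]
      congr 1
      rw [Measure.real, Real.volume_Ioc, ENNReal.toReal_ofReal (sub_nonneg.2 hle)]
      push_cast; ring
    · intro x hx
      have : ⌈x * N⌉₊ = k + 1 := by
        rw [Nat.ceil_eq_iff (Nat.succ_ne_zero k)]
        exact ⟨by simpa using (div_lt_iff₀ hN').1 hx.1, (le_div_iff₀ hN').1 hx.2⟩
      simp only [this]
  · intro k _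
    rw [intervalIntegrable_iff]
    exact Measure.integrableOn_of_bounded (M := C) (by simp)
      (measurable_comp_ceil_div g N).aestronglyMeasurable (ae_of_all _ fun x => hC _)

theorem tendsto_riemannSum_right {g : ℝ → ℝ} {C : ℝ} (hC : ∀ x, |g x| ≤ C)
    (hg : ∀ x ∈ Set.Ico (0 : ℝ) 1, ContinuousWithinAt g (Set.Ici x) x) :
    Tendsto (fun N : ℕ => ∑ k ∈ Finset.range N, g ((k + 1 : ℕ) / N) * (1 / N)) atTop
      (𝓝 (∫ x in (0 : ℝ)..1, g x)) := by
  have h : Tendsto (fun N : ℕ => ∫ x in (0 : ℝ)..1, g (⌈x * N⌉₊ / N)) atTop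
      (𝓝 (∫ x in (0 : ℝ)..1, g x)) := by
    refine intervalIntegral.tendsto_integral_filter_of_dominated_convergence (fun _ => C)
      (Eventually.of_forall fun N => (measurable_comp_ceil_div g N).aestronglyMeasurable)
      (Eventually.of_forall fun N => ae_of_all _ fun x _ => hC _) (by simp) ?_
    -- Right-continuity is only given on `[0, 1)`; the endpoint is a null set.
    have : ∀ᵐ x : ℝ, x ≠ 1 := by simp [ae_iff]
    filter_upwards [this] with x hx1 hx
    rw [Set.uIoc_of_le zero_le_one] at hx
    exact tendsto_comp_ceil_div hg ⟨hx.1.le, lt_of_le_of_ne hx.2 hx1⟩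
  refine h.congr' ?_
  filter_upwards [eventually_gt_atTop 0] with N hN
  exact integral_comp_ceil_div g hC hN

/-- Right-endpoint Riemann sums of a bounded right-continuous function on `[a, b]`. -/
theorem tendsto_riemannSum_right_Icc {f : ℝ → ℝ} {C a b : ℝ} (hab : a ≤ b) (hC : ∀ x, |f x| ≤ C)
    (hf : ∀ x ∈ Set.Ico a b, ContinuousWithinAt f (Set.Ici x) x) :
    IntervalIntegrable f volume a b ∧
    Tendsto (fun N : ℕ => ∑ k ∈ Finset.range N,
      ((b - a) / N) * f (a + (k + 1 : ℕ) * ((b - a) / N))) atTop (𝓝 (∫ x in a..b, f x)) := by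
  rcases hab.eq_or_lt with rfl | hab
  · simp
  have hc : 0 < b - a := sub_pos.2 hab
  let g : ℝ → ℝ := fun x => f (a + (b - a) * x)
  have hg : ∀ x ∈ Set.Ico (0 : ℝ) 1, ContinuousWithinAt g (Set.Ici x) x := by
    intro x hx
    refine ContinuousWithinAt.comp (t := Set.Ici (a + (b - a) * x)) (hf _ ⟨?_, ?_⟩)
      (by fun_prop) ?_
    · nlinarith [hx.1]
    · nlinarith [hx.2]
    · intro y (hy : x ≤ y)
      exact add_le_add_right (mul_le_mul_of_nonneg_left hy hc.le) a
  have hgC : ∀ x, |g x| ≤ C := fun x => hC _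
  constructor
  · have h := (intervalIntegrable_of_bounded_of_rightContinuous hgC hg).comp_mul_left
      (c := (b - a)⁻¹)
    have h' := h.comp_sub_right a
    simp only [g] at h'
    convert! h' using 1
    · ext x; congr 1; field_simp; ring
    · field_simp; ring
    · field_simp; ring
  · have h := (tendsto_riemannSum_right hgC hg).const_mul (b - a)
    have h2 : (b - a) * ∫ x in (0 : ℝ)..1, g x = ∫ x in a..b, f x := by
      simp [g]
    rw [h2] at h
    refine h.congr fun N => ?_
    rw [Finset.mul_sum]
    refine Finset.sum_congr rfl fun k _ => ?_
    have : a + (b - a) * ((k + 1 : ℕ) / N) = a + (k + 1 : ℕ) * ((b - a) / N) := by ring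
    simp only [g, this]
    ring

/-! ### Discrete discounting through the Markov property -/

section Markov

variable {n : ℕ} {Ω : Type*} {mΩ : MeasurableSpace Ω} {Q : Measure Ω} [IsProbabilityMeasure Q]
  {F : Filtration ℝ mΩ} {Tbar : ℝ} {J : ℝ → Ω → Fin n} {P : ℝ → Matrix (Fin n) (Fin n) ℝ}

/-- The Markov property of `J` with respect to `F` with transition matrices `P`. -/
def MarkovProperty (Q : Measure Ω) (F : Filtration ℝ mΩ) (Tbar : ℝ) (J : ℝ → Ω → Fin n)
    (P : ℝ → Matrix (Fin n) (Fin n) ℝ) : Prop :=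
  ∀ s t, 0 ≤ s → s ≤ t → t ≤ Tbar → ∀ j : Fin n,
    Q[(J t ⁻¹' {j}).indicator (fun _ => (1 : ℝ)) | F s] =ᵐ[Q] fun ω => P (t - s) (J s ω) j

theorem abs_le_sum_abs (ψ : Fin n → ℝ) (j : Fin n) : |ψ j| ≤ ∑ k, |ψ k| :=
  Finset.single_le_sum (f := fun k => |ψ k|) (fun _ _ => abs_nonneg _) (Finset.mem_univ j)

theorem integrable_mul_comp_state {t : ℝ} (hJt : Measurable (J t)) {Z : Ω → ℝ} (hZ : Measurable Z)
    {C : ℝ} (hC : ∀ ω, |Z ω| ≤ C) (ψ : Fin n → ℝ) :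
    Integrable (fun ω => Z ω * ψ (J t ω)) Q := by
  refine Integrable.of_bound
    (hZ.mul ((measurable_of_finite ψ).comp hJt)).aestronglyMeasurable (C * ∑ k, |ψ k|)
    (ae_of_all _ fun ω => ?_)
  rw [Real.norm_eq_abs, abs_mul]
  exact mul_le_mul (hC ω) (abs_le_sum_abs ψ _) (abs_nonneg _) ((abs_nonneg _).trans (hC ω))

/-- The weight `Z` is known at time `s`, so it can be pulled out of the conditional expectation. -/
theorem integral_mul_indicator_state (hJ : ∀ t ∈ Set.Icc 0 Tbar, Measurable[F t] (J t))
    (hM : MarkovProperty Q F Tbar J P) {s t : ℝ} (hs : 0 ≤ s) (hst : s ≤ t) (htT : t ≤ Tbar)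
    {Z : Ω → ℝ} (hZ : Measurable[F s] Z) {C : ℝ} (hC : ∀ ω, |Z ω| ≤ C) (j : Fin n) :
    ∫ ω, Z ω * (J t ⁻¹' {j}).indicator (fun _ => (1 : ℝ)) ω ∂Q =
      ∫ ω, Z ω * P (t - s) (J s ω) j ∂Q := by
  have hJt : Measurable (J t) := (hJ t ⟨hs.trans hst, htT⟩).mono (F.le t) le_rfl
  have hZ' : Measurable Z := hZ.mono (F.le s) le_rfl
  have hset : MeasurableSet (J t ⁻¹' {j}) := hJt (measurableSet_singleton j)
  have hind : Integrable ((J t ⁻¹' {j}).indicator (fun _ => (1 : ℝ))) Q :=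
    (integrable_const _).indicator hset
  have hprod : Integrable (Z * (J t ⁻¹' {j}).indicator (fun _ => (1 : ℝ))) Q := by
    have := integrable_mul_comp_state (Q := Q) hJt hZ' hC (fun k => if k = j then (1 : ℝ) else 0)
    refine this.congr (ae_of_all _ fun ω => ?_)
    by_cases h : J t ω = j <;> simp [h]
  have h1 := condExp_mul_of_stronglyMeasurable_left hZ.stronglyMeasurable hprod hind
  have h2 : ∫ ω, (Z * (J t ⁻¹' {j}).indicator (fun _ => (1 : ℝ))) ω ∂Q = _ :=
    (integral_condExp (F.le s)).symm
  have h3 : ∫ ω, Z ω * (J t ⁻¹' {j}).indicator (fun _ => (1 : ℝ)) ω ∂Q =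
      ∫ ω, (Z * (J t ⁻¹' {j}).indicator (fun _ => (1 : ℝ))) ω ∂Q := rfl
  rw [h3, h2]
  refine integral_congr_ae ?_
  filter_upwards [h1, hM s t hs hst htT j] with ω h4 h5
  rw [h4, Pi.mul_apply, h5]

theorem integral_mul_comp_state (hJ : ∀ t ∈ Set.Icc 0 Tbar, Measurable[F t] (J t))
    (hM : MarkovProperty Q F Tbar J P) {s t : ℝ} (hs : 0 ≤ s) (hst : s ≤ t) (htT : t ≤ Tbar)
    {Z : Ω → ℝ} (hZ : Measurable[F s] Z) {C : ℝ} (hC : ∀ ω, |Z ω| ≤ C) (ψ : Fin n → ℝ) :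
    ∫ ω, Z ω * ψ (J t ω) ∂Q = ∫ ω, Z ω * (P (t - s)).mulVec ψ (J s ω) ∂Q := by
  have hJt : Measurable (J t) := (hJ t ⟨hs.trans hst, htT⟩).mono (F.le t) le_rfl
  have hJs : Measurable (J s) := (hJ s ⟨hs, hst.trans htT⟩).mono (F.le s) le_rfl
  have hZ' : Measurable Z := hZ.mono (F.le s) le_rfl
  have h1 : ∀ ω, Z ω * ψ (J t ω) =
      ∑ j, (Z ω * (J t ⁻¹' {j}).indicator (fun _ => (1 : ℝ)) ω) * ψ j := by
    intro ω
    rw [Finset.sum_eq_single (J t ω)]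
    · simp
    · intro j _ hj
      simp [hj.symm]
    · simp
  have h2 : ∀ ω, Z ω * (P (t - s)).mulVec ψ (J s ω) =
      ∑ j, (Z ω * P (t - s) (J s ω) j) * ψ j := by
    intro ω
    simp only [Matrix.mulVec, dotProduct, Finset.mul_sum, mul_assoc]
  simp_rw [h1, h2]
  rw [integral_finsetSum, integral_finsetSum]
  · refine Finset.sum_congr rfl fun j _ => ?_
    rw [integral_mul_const, integral_mul_const,
      integral_mul_indicator_state hJ hM hs hst htT hZ hC j]
  · exact fun j _ => (integrable_mul_comp_state hJs hZ' hC fun k => P (t - s) k j).mul_const _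
  · intro j _
    refine Integrable.mul_const ?_ _
    have := integrable_mul_comp_state (Q := Q) hJt hZ' hC (fun k => if k = j then (1 : ℝ) else 0)
    refine this.congr (ae_of_all _ fun ω => ?_)
    by_cases h : J t ω = j <;> simp [h]

/-- One step of the discretely discounted chain with step size `h`. -/
noncomputable def discountedStep (P : ℝ → Matrix (Fin n) (Fin n) ℝ) (r : Fin n → ℝ) (h : ℝ) :
    Matrix (Fin n) (Fin n) ℝ :=
  P h * Matrix.diagonal fun j => Real.exp (-(h * r j))

/-- Induction peels off the last step. Its discount factor depends only on the final state and is
absorbed into `ψ`, hence `ψ` is generalized; all earlier factors are known at `s + N * h` and join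
the weight `Z`. -/
theorem integral_mul_exp_riemannSum (hJ : ∀ t ∈ Set.Icc 0 Tbar, Measurable[F t] (J t))
    (hM : MarkovProperty Q F Tbar J P) (r : Fin n → ℝ) {s h : ℝ} (hs : 0 ≤ s) (hh : 0 ≤ h)
    {Z : Ω → ℝ} (hZ : Measurable[F s] Z) {C : ℝ} (hC : ∀ ω, |Z ω| ≤ C) (N : ℕ)
    (hN : s + N * h ≤ Tbar) (ψ : Fin n → ℝ) :
    ∫ ω, Z ω * (Real.exp (-∑ k ∈ Finset.range N, h * r (J (s + (k + 1 : ℕ) * h) ω)) *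
        ψ (J (s + N * h) ω)) ∂Q =
      ∫ ω, Z ω * (discountedStep P r h ^ N).mulVec ψ (J s ω) ∂Q := by
  induction N generalizing ψ with
  | zero => simp
  | succ N ih =>
    have hstep : s + N * h ≤ s + (N + 1 : ℕ) * h := by push_cast; nlinarith
    have hN' : s + N * h ≤ Tbar := hstep.trans hN
    have hsN : 0 ≤ s + N * h := by positivity
    let D : Ω → ℝ := fun ω =>
      Real.exp (-∑ k ∈ Finset.range N, h * r (J (s + (k + 1 : ℕ) * h) ω))
    have hD : Measurable[F (s + N * h)] D := by
      refine Real.measurable_exp.comp (Measurable.neg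
        (Finset.measurable_fun_sum _ fun k hk => Measurable.const_mul ?_ _))
      have hk' : s + (k + 1 : ℕ) * h ≤ s + N * h := by
        have : ((k + 1 : ℕ) : ℝ) ≤ N := by exact_mod_cast Finset.mem_range.1 hk
        gcongr
      exact (measurable_of_finite r).comp
        ((hJ _ ⟨by positivity, hk'.trans hN'⟩).mono (F.mono hk') le_rfl)
    have hDC : ∀ ω, |D ω| ≤ Real.exp (N * (h * ∑ j, |r j|)) := by
      intro ω
      rw [Real.abs_exp, Real.exp_le_exp, ← Finset.sum_neg_distrib]
      refine (Finset.sum_le_card_nsmul _ _ (h * ∑ j, |r j|) fun k _ => ?_).trans (by simp)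
      rw [← mul_neg]
      exact mul_le_mul_of_nonneg_left ((neg_le_abs _).trans (abs_le_sum_abs r _)) hh
    have hZD : Measurable[F (s + N * h)] fun ω => Z ω * D ω :=
      (hZ.mono (F.mono (by nlinarith [mul_nonneg N.cast_nonneg hh])) le_rfl).mul hD
    have hZDC : ∀ ω, |Z ω * D ω| ≤ C * Real.exp (N * (h * ∑ j, |r j|)) := by
      intro ω
      rw [abs_mul]
      exact mul_le_mul (hC ω) (hDC ω) (abs_nonneg _) ((abs_nonneg _).trans (hC ω))
    have h1 := integral_mul_comp_state hJ hM hsN hstep hN hZD hZDC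
      (fun j => Real.exp (-(h * r j)) * ψ j)
    have h2 : s + (N + 1 : ℕ) * h - (s + N * h) = h := by push_cast; ring
    have h3 : (P h).mulVec (fun j => Real.exp (-(h * r j)) * ψ j) =
        (discountedStep P r h).mulVec ψ := by
      rw [discountedStep, ← Matrix.mulVec_mulVec]
      congr 1
      ext j
      rw [Matrix.mulVec_diagonal]
    rw [h2, h3] at h1
    have h4 := ih hN' ((discountedStep P r h).mulVec ψ)
    rw [Matrix.mulVec_mulVec, ← pow_succ] at h4
    rw [← h4]
    simp only [D, mul_assoc] at h1
    rw [← h1]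
    congr 1
    ext ω
    rw [Finset.sum_range_succ, neg_add, Real.exp_add, mul_assoc]

end Markov

/-! ### Limit of the step matrices and positivity of transition probabilities -/

section Matrices

variable {n : ℕ} {P : ℝ → Matrix (Fin n) (Fin n) ℝ} {G : Matrix (Fin n) (Fin n) ℝ}

-- Product rule at `0`, where both factors equal the identity: the right derivative is `G - R`.
open scoped Matrix.Norms.Operator in
theorem tendsto_discountedStep_pow [NeZero n] (hP : IsTransitionFunction P)
    (hG : IsGeneratorOf G P) (r : Fin n → ℝ) {τ : ℝ} (hτ : 0 ≤ τ) :
    Tendsto (fun N : ℕ => discountedStep P r (τ / N) ^ N) atTop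
      (𝓝 (NormedSpace.exp (τ • (G - Matrix.diagonal r)))) := by
  refine tendsto_pow_exp_of_hasDerivWithinAt (X := discountedStep P r) ?_ ?_ hτ
  · simp [discountedStep, hP.zero]
  · refine hasDerivWithinAt_pi.2 fun i => hasDerivWithinAt_pi.2 fun j => ?_
    have h1 : HasDerivWithinAt (fun h : ℝ => Real.exp (-(h * r j))) (-r j) (Set.Ici 0) 0 := by
      have := ((hasDerivAt_id (0 : ℝ)).mul_const (r j)).neg.exp
      simpa using this.hasDerivWithinAt
    have h2 := (hG i j).mul h1
    simp only [discountedStep, Matrix.mul_diagonal]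
    convert! h2 using 1
    by_cases hij : i = j
    · subst hij; simp [hP.zero]; ring
    · simp [hP.zero, hij]

theorem IsTransitionFunction.mul_le_apply_add (hP : IsTransitionFunction P) {s t : ℝ} (hs : 0 ≤ s)
    (ht : 0 ≤ t) (i j k : Fin n) : P s i j * P t j k ≤ P (s + t) i k := by
  rw [hP.add s t hs ht, Matrix.mul_apply]
  exact Finset.single_le_sum (f := fun j => P s i j * P t j k)
    (fun l _ => mul_nonneg (hP.nonneg s hs i l) (hP.nonneg t ht l k)) (Finset.mem_univ j)

/-- Continuity at `0` gives positivity at a small time `t / N`; staying put over `N` such steps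
bounds `P t i i` from below. -/
theorem IsTransitionFunction.diag_pos (hP : IsTransitionFunction P) (hG : IsGeneratorOf G P)
    {t : ℝ} (ht : 0 ≤ t) (i : Fin n) : 0 < P t i i := by
  have hcont : Tendsto (fun h => P h i i) (𝓝[≥] 0) (𝓝 1) := by
    have := (hG i i).continuousWithinAt.tendsto
    simpa [hP.zero] using this
  have hlim : Tendsto (fun N : ℕ => t / (N : ℝ)) atTop (𝓝[≥] 0) :=
    tendsto_nhdsWithin_iff.2 ⟨tendsto_const_div_atTop_nhds_zero_nat t,
      Eventually.of_forall fun N => div_nonneg ht N.cast_nonneg⟩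
  obtain ⟨N, hN, hN0⟩ := ((hlim.eventually (hcont.eventually (lt_mem_nhds zero_lt_one))).and
    (eventually_gt_atTop 0)).exists
  have hh : 0 ≤ t / N := by positivity
  have key : ∀ m : ℕ, 0 < P (m * (t / N)) i i := by
    intro m
    induction m with
    | zero => simp [hP.zero]
    | succ m ih =>
      have := hP.mul_le_apply_add (s := m * (t / N)) (by positivity) hh i i i
      rw [show ((m + 1 : ℕ) : ℝ) * (t / N) = m * (t / N) + t / N by push_cast; ring]
      exact (mul_pos ih hN).trans_le this
  have hN' : (N : ℝ) ≠ 0 := by exact_mod_cast hN0.ne'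
  simpa [mul_div_cancel₀ _ hN'] using key N

/-- Move to `j` within some `h < t`, where the difference quotient is positive, then remain there
for `t - h`. -/
theorem IsTransitionFunction.apply_pos_of_rate_pos (hP : IsTransitionFunction P)
    (hG : IsGeneratorOf G P) {t : ℝ} (ht : 0 < t) {i j : Fin n} (hij : i ≠ j) (hg : 0 < G i j) :
    0 < P t i j := by
  have h1 : Tendsto (slope (fun t => P t i j) 0) (𝓝[>] 0) (𝓝 (G i j)) := by
    have := hasDerivWithinAt_iff_tendsto_slope.1 (hG i j)
    simpa using this
  obtain ⟨h, hpos, hh0, hlt⟩ :=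
    ((h1.eventually (lt_mem_nhds hg)).and (Ioo_mem_nhdsGT ht)).exists
  have hPh : 0 < P h i j := by
    simp only [slope_def_field, hP.zero, Matrix.one_apply_ne hij, sub_zero] at hpos
    exact (div_pos_iff_of_pos_right hh0).1 hpos
  have h2 := hP.mul_le_apply_add hh0.le (sub_nonneg.2 hlt.le) i j j
  rw [add_sub_cancel] at h2
  exact (mul_pos hPh (hP.diag_pos hG (sub_nonneg.2 hlt.le) j)).trans_le h2

theorem IsTransitionFunction.apply_pos_of_irreducible (hP : IsTransitionFunction P)
    (hG : IsGeneratorOf G P) (hirr : IsIrreducible G) {t : ℝ} (ht : 0 < t) (i j : Fin n) :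
    0 < P t i j := by
  have h := hirr i j
  -- Each edge of the path takes half of the remaining time.
  induction h generalizing t with
  | refl => exact hP.diag_pos hG ht.le i
  | @tail b c _ hbc ih =>
    have h2 := hP.mul_le_apply_add (half_pos ht).le (half_pos ht).le i b c
    rw [add_halves] at h2
    exact (mul_pos (ih (half_pos ht))
      (hP.apply_pos_of_rate_pos hG (half_pos ht) hbc.1 hbc.2)).trans_le h2

end Matrices

/-! ### From the discrete price to the price -/

section Price

variable {n : ℕ} {Ω : Type*} {mΩ : MeasurableSpace Ω} {Q : Measure Ω}
  {F : Filtration ℝ mΩ} {Tbar : ℝ} {J : ℝ → Ω → Fin n} {G : Matrix (Fin n) (Fin n) ℝ}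

/-- `Q(J_t = i)` is the mean of `P t (J 0) i`, which is positive whatever the initial law. -/
theorem IsCTMC.measure_state_pos [IsProbabilityMeasure Q]
    (hJ : IsCTMC Q F Tbar J G) (hirr : IsIrreducible G) {t : ℝ}
    (ht : 0 < t) (htT : t ≤ Tbar) (i : Fin n) : 0 < Q (J t ⁻¹' {i}) := by
  obtain ⟨P, hP, hG, hM⟩ := hJ.markov
  have hJ0 : Measurable (J 0) := (hJ.adapted 0 ⟨le_rfl, ht.le.trans htT⟩).mono (F.le 0) le_rfl
  have hJt : Measurable (J t) := (hJ.adapted t ⟨ht.le, htT⟩).mono (F.le t) le_rfl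
  have h1 := integral_mul_indicator_state hJ.adapted hM le_rfl ht.le htT
    (Z := fun _ => 1) measurable_const (C := 1) (by simp) i
  simp only [one_mul, sub_zero] at h1
  rw [integral_indicator_const _ (hJt (measurableSet_singleton i)), smul_eq_mul, mul_one] at h1
  have hpos : ∀ ω, 0 < P t (J 0 ω) i := fun ω => hP.apply_pos_of_irreducible hG hirr ht _ _
  have hint : Integrable (fun ω => P t (J 0 ω) i) Q := by
    simpa using integrable_mul_comp_state (Q := Q) hJ0 (Z := fun _ => 1) measurable_const
      (C := 1) (by simp) fun k => P t k i
  have h2 : 0 < ∫ ω, P t (J 0 ω) i ∂Q := by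
    rw [integral_pos_iff_support_of_nonneg (fun ω => (hpos ω).le) hint]
    have : Function.support (fun ω => P t (J 0 ω) i) = Set.univ :=
      Set.eq_univ_of_forall fun ω => (hpos ω).ne'
    simp [this]
  rw [← h1] at h2
  exact (ENNReal.toReal_pos_iff.1 h2).1

theorem IsCTMC.ae_tendsto_riemannSum (hJ : IsCTMC Q F Tbar J G) (r : Fin n → ℝ) {t T : ℝ}
    (ht : 0 ≤ t) (htT : t ≤ T) (hT : T ≤ Tbar) :
    ∀ᵐ ω ∂Q, IntervalIntegrable (fun s => r (J s ω)) volume t T ∧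
      Tendsto (fun N : ℕ => ∑ k ∈ Finset.range N,
        ((T - t) / N) * r (J (t + (k + 1 : ℕ) * ((T - t) / N)) ω)) atTop
        (𝓝 (∫ s in t..T, r (J s ω))) := by
  filter_upwards [hJ.right_continuous] with ω hω
  refine tendsto_riemannSum_right_Icc htT (fun x => abs_le_sum_abs r (J x ω)) fun x hx => ?_
  exact (continuous_of_discreteTopology (f := r)).continuousAt.comp_continuousWithinAt
    (hω x ⟨ht.trans hx.1, hx.2.trans_le hT⟩)

/-- The payoff discounted along the right-endpoint Riemann sum with `N` steps. -/
noncomputable def discretePayoff (J : ℝ → Ω → Fin n) (r φ : Fin n → ℝ) (t T : ℝ) (N : ℕ)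
    (ω : Ω) : ℝ :=
  Real.exp (-∑ k ∈ Finset.range N, ((T - t) / N) * r (J (t + (k + 1 : ℕ) * ((T - t) / N)) ω)) *
    φ (J T ω)

theorem IsCTMC.measurable_discretePayoff (hJ : IsCTMC Q F Tbar J G) (r φ : Fin n → ℝ) {t T : ℝ}
    (ht : 0 ≤ t) (htT : t ≤ T) (hT : T ≤ Tbar) (N : ℕ) :
    Measurable (discretePayoff J r φ t T N) := by
  have hJm : ∀ s ∈ Set.Icc 0 Tbar, Measurable (J s) := fun s hs =>
    (hJ.adapted s hs).mono (F.le s) le_rfl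
  have hc : 0 ≤ T - t := sub_nonneg.2 htT
  refine (Real.measurable_exp.comp (Measurable.neg
    (Finset.measurable_fun_sum _ fun k hk => Measurable.const_mul ?_ _))).mul
    ((measurable_of_finite φ).comp (hJm T ⟨ht.trans htT, hT⟩))
  refine (measurable_of_finite r).comp (hJm _ ⟨by positivity, le_trans ?_ hT⟩)
  have hk' : ((k + 1 : ℕ) : ℝ) ≤ N := by exact_mod_cast Finset.mem_range.1 hk
  have hN : (0 : ℝ) < N := lt_of_lt_of_le (by positivity) hk'
  calc t + (k + 1 : ℕ) * ((T - t) / N) ≤ t + N * ((T - t) / N) := by gcongr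
    _ = T := by field_simp; ring

theorem abs_discretePayoff_le (J : ℝ → Ω → Fin n) (r φ : Fin n → ℝ) {t T : ℝ} (htT : t ≤ T)
    (N : ℕ) (ω : Ω) :
    |discretePayoff J r φ t T N ω| ≤ Real.exp ((T - t) * ∑ j, |r j|) * ∑ j, |φ j| := by
  have hc : 0 ≤ T - t := sub_nonneg.2 htT
  rw [discretePayoff, abs_mul, Real.abs_exp]
  refine mul_le_mul (Real.exp_le_exp.2 ?_) (abs_le_sum_abs φ _) (abs_nonneg _) (by positivity)
  -- For `N = 0` the sum is empty; otherwise `N` cancels, making the bound uniform in `N`.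
  rcases N.eq_zero_or_pos with rfl | hN
  · simpa using by positivity
  rw [← Finset.sum_neg_distrib]
  refine (Finset.sum_le_card_nsmul _ _ ((T - t) / N * ∑ j, |r j|) fun k _ => ?_).trans
    (le_of_eq ?_)
  · rw [← mul_neg]
    exact mul_le_mul_of_nonneg_left ((neg_le_abs _).trans (abs_le_sum_abs r _)) (by positivity)
  · have hN' : (N : ℝ) ≠ 0 := by exact_mod_cast hN.ne'
    rw [Finset.card_range, nsmul_eq_mul]
    field_simp

theorem IsCTMC.ae_tendsto_discretePayoff (hJ : IsCTMC Q F Tbar J G) (r φ : Fin n → ℝ) {t T : ℝ}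
    (ht : 0 ≤ t) (htT : t ≤ T) (hT : T ≤ Tbar) :
    ∀ᵐ ω ∂Q, Tendsto (fun N => discretePayoff J r φ t T N ω) atTop
      (𝓝 (discountedPayoff J r φ t T ω)) := by
  filter_upwards [hJ.ae_tendsto_riemannSum r ht htT hT] with ω hω
  exact ((Real.continuous_exp.tendsto _).comp hω.2.neg).mul_const _

/-- Measurability and the bound both pass to the almost sure limit of the discrete payoffs. -/
theorem IsCTMC.integrable_discountedPayoff [IsProbabilityMeasure Q]
    (hJ : IsCTMC Q F Tbar J G) (r φ : Fin n → ℝ) {t T : ℝ}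
    (ht : 0 ≤ t) (htT : t ≤ T) (hT : T ≤ Tbar) :
    Integrable (discountedPayoff J r φ t T) Q := by
  have hlim := hJ.ae_tendsto_discretePayoff r φ ht htT hT
  refine Integrable.of_bound (aestronglyMeasurable_of_tendsto_ae atTop
    (fun N => (hJ.measurable_discretePayoff r φ ht htT hT N).aestronglyMeasurable) hlim)
    (Real.exp ((T - t) * ∑ j, |r j|) * ∑ j, |φ j|) ?_
  filter_upwards [hlim] with ω hω
  exact le_of_tendsto hω.norm (Eventually.of_forall fun N => abs_discretePayoff_le J r φ htT N ω)

theorem IsCTMC.setIntegral_discountedPayoff [IsProbabilityMeasure Q]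
    (hJ : IsCTMC Q F Tbar J G) (r φ : Fin n → ℝ)
    {t T : ℝ} (ht : 0 ≤ t) (htT : t ≤ T) (hT : T ≤ Tbar) (i : Fin n) :
    ∫ ω in J t ⁻¹' {i}, discountedPayoff J r φ t T ω ∂Q =
      Q.real (J t ⁻¹' {i}) *
        (NormedSpace.exp ((T - t) • (G - Matrix.diagonal r))).mulVec φ i := by
  obtain ⟨P, hP, hG, hM⟩ := hJ.markov
  have : NeZero n := ⟨fun h => (Fin.cast h i).elim0⟩
  have hset' : MeasurableSet[F t] (J t ⁻¹' {i}) :=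
    hJ.adapted t ⟨ht, htT.trans hT⟩ (measurableSet_singleton i)
  have hset : MeasurableSet (J t ⁻¹' {i}) := F.le t _ hset'
  have hc : 0 ≤ T - t := sub_nonneg.2 htT
  have hL : Tendsto (fun N => ∫ ω in J t ⁻¹' {i}, discretePayoff J r φ t T N ω ∂Q) atTop
      (𝓝 (∫ ω in J t ⁻¹' {i}, discountedPayoff J r φ t T ω ∂Q)) :=
    tendsto_integral_of_dominated_convergence
      (fun _ => Real.exp ((T - t) * ∑ j, |r j|) * ∑ j, |φ j|)
      (fun N => (hJ.measurable_discretePayoff r φ ht htT hT N).aestronglyMeasurable)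
      (integrable_const _) (fun N => ae_of_all _ (abs_discretePayoff_le J r φ htT N))
      (ae_restrict_of_ae (hJ.ae_tendsto_discretePayoff r φ ht htT hT))
  have hR : Tendsto (fun N : ℕ => Q.real (J t ⁻¹' {i}) *
      (discountedStep P r ((T - t) / N) ^ N).mulVec φ i) atTop
      (𝓝 (Q.real (J t ⁻¹' {i}) *
        (NormedSpace.exp ((T - t) • (G - Matrix.diagonal r))).mulVec φ i)) := by
    have hcont : Continuous fun A : Matrix (Fin n) (Fin n) ℝ => A.mulVec φ i :=
      (continuous_apply i).comp (continuous_id.matrix_mulVec continuous_const)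
    exact ((hcont.tendsto _).comp (tendsto_discountedStep_pow hP hG r hc)).const_mul _
  refine tendsto_nhds_unique hL (hR.congr' ?_)
  filter_upwards [eventually_gt_atTop 0] with N hN
  have hN' : (N : ℝ) ≠ 0 := by exact_mod_cast hN.ne'
  -- This needs `N > 0`: with `N = 0` the grid would end at `t`.
  have hend : t + N * ((T - t) / N) = T := by field_simp; ring
  -- The weight is the indicator of `J t = i`, so the start vector contributes only its `i`-th
  -- entry.
  have h1 := integral_mul_exp_riemannSum hJ.adapted hM r (h := (T - t) / N) ht (by positivity)
    (Z := (J t ⁻¹' {i}).indicator fun _ => 1) (measurable_const.indicator hset') (C := 1)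
    (fun ω => by by_cases h : J t ω = i <;> simp [h]) N (hend.trans_le hT) φ
  rw [hend] at h1
  rw [← integral_indicator hset]
  have h2 : ∀ ω, (J t ⁻¹' {i}).indicator (discretePayoff J r φ t T N) ω =
      (J t ⁻¹' {i}).indicator (fun _ => 1) ω * discretePayoff J r φ t T N ω := by
    intro ω
    by_cases h : J t ω = i <;> simp [h]
  have h3 : ∀ ω, (J t ⁻¹' {i}).indicator (fun _ => (1 : ℝ)) ω *
      (discountedStep P r ((T - t) / N) ^ N).mulVec φ (J t ω) =
      (J t ⁻¹' {i}).indicator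
        (fun _ => (discountedStep P r ((T - t) / N) ^ N).mulVec φ i) ω := by
    intro ω
    by_cases h : J t ω = i <;> simp [h]
  simp_rw [h2]
  simp_rw [h3] at h1
  rw [integral_indicator_const _ hset, smul_eq_mul] at h1
  exact h1.symm

theorem IsCTMC.price_eq [IsProbabilityMeasure Q]
    (hJ : IsCTMC Q F Tbar J G) (r φ : Fin n → ℝ)
    {t T : ℝ} (ht : 0 ≤ t) (htT : t ≤ T) (hT : T ≤ Tbar) {i : Fin n}
    (hi : 0 < Q (J t ⁻¹' {i})) :
    price Q J r φ t T i =
      (NormedSpace.exp ((T - t) • (G - Matrix.diagonal r))).mulVec φ i := by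
  rw [price, ProbabilityTheory.cond, integral_smul_measure,
    hJ.setIntegral_discountedPayoff r φ ht htT hT i, smul_eq_mul, ENNReal.toReal_inv]
  refine inv_mul_cancel_left₀ ?_ _
  exact (ENNReal.toReal_pos hi.ne' (measure_ne_top _ _)).ne'

end Price

end CTMC

theorem proposition1 {n : ℕ} {Ω : Type*} {mΩ : MeasurableSpace Ω} (Q : Measure Ω)
    [IsProbabilityMeasure Q] (F : Filtration ℝ mΩ) (Tbar : ℝ) (J : ℝ → Ω → Fin n)
    (G : Matrix (Fin n) (Fin n) ℝ) (hJ : CTMC.IsCTMC Q F Tbar J G)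
    (r φ : Fin n → ℝ) (t T : ℝ) (ht : 0 ≤ t) (htT : t ≤ T) (hT : T ≤ Tbar) :
    (∀ᵐ ω ∂Q, IntervalIntegrable (fun s => r (J s ω)) volume t T) ∧
    Integrable (CTMC.discountedPayoff J r φ t T) Q ∧
    (∀ i, 0 < Q (J t ⁻¹' {i}) →
      CTMC.price Q J r φ t T i =
        (NormedSpace.exp ((T - t) • (G - Matrix.diagonal r))).mulVec φ i) ∧
    (CTMC.IsIrreducible G → 0 < t →
      (∀ i, 0 < Q (J t ⁻¹' {i})) ∧
      CTMC.price Q J r φ t T =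
        (NormedSpace.exp ((T - t) • (G - Matrix.diagonal r))).mulVec φ) := by
  refine ⟨(hJ.ae_tendsto_riemannSum r ht htT hT).mono fun _ h => h.1,
    hJ.integrable_discountedPayoff r φ ht htT hT, fun i => hJ.price_eq r φ ht htT hT,
    fun hirr ht0 => ?_⟩
  have hpos : ∀ i, 0 < Q (J t ⁻¹' {i}) := hJ.measure_state_pos hirr ht0 (htT.trans hT)
  exact ⟨hpos, funext fun i => hJ.price_eq r φ ht htT hT (hpos i)⟩
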